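/- Corollary 3.4. For a complex vector space $X$ with a vector space topology and $n\ge 1$, let $X_n\subset X^n$ be the set of linearly independent $n$-tuples with the topology induced by $X^n$, let $\mathbb P_n(X)$ be the set of $n$-dimensional subspaces of $X$, and give $\mathbb P_n(X)$ the topology for which the surjection $X_n\to\mathbb P_n(X)$, $(x_1,\dots,x_n)\mapsto\operatorname{span}(x_1,\dots,x_n)$, is continuous and open (the quotient topology). A continuous linear operator $T$ on $X$ is strongly $n$-supercyclic if there is a subspace $L\subset X$ such that $T^k(L)$ has dimension $n$ for every integer $k\ge 0$ and $\{T^k(L):k\ge 0\}$ is dense in $\mathbb P_n(X)$. It is hypercyclic if $\{T^kx:k\ge 0\}$ is dense in $X$ for some $x\in X$, and supercyclic if $\{\lambda T^kx:k\ge 0,\ \lambda\in\mathbb C\}$ is dense in $X$ for some $x\in X$. Let $X$ be a complex Banach space and let $T$ be a strongly $2$-supercyclic bounded linear operator on $X$. Then at least one of the following holds. (1) There is $R\ge 0$ such that the circle $\{z\in\mathbb C:|z|=R\}$ intersects every connected component of the spectrum $\sigma(T)$. (2) There are $a\in\mathbb C\setminus\{0\}$ and a topological direct sum decomposition $X=F\oplus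 X_0$ into closed $T$-invariant subspaces with $\dim F=1$, such that $T|_F=a\,\mathrm{Id}$ and $S:=T|_{X_0}$ is supercyclic. (3) There are $a,b\in\mathbb C\setminus\{0\}$ and a topological direct sum decomposition $X=F_1\oplus F_2\oplus X_0$ into closed $T$-invariant subspaces with $\dim F_1=\dim F_2=1$, such that $T|_{F_1}=a\,\mathrm{Id}$, $T|_{F_2}=b\,\mathrm{Id}$ and, with $S:=T|_{X_0}$, the operator $\frac{S}{a}\oplus\frac{S}{b}$ is hypercyclic on $X_0\oplus X_0$. -/

import Mathlib

namespace LinDyn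

section Grassmannian

variable (𝕜 : Type*) [NontriviallyNormedField 𝕜] (n : ℕ)
  (X : Type*) [AddCommGroup X] [Module 𝕜 X]

/-- The set of linearly independent `n`-tuples of vectors of `X`; it carries the topology
induced by the product topology of `X ^ n` as soon as `X` has a topology. -/
abbrev Frame : Type _ := {x : Fin n → X // LinearIndependent 𝕜 x}

/-- The set of all `n`-dimensional subspaces of `X`. -/
def Grassmannian : Type _ :=
  {L : Submodule 𝕜 X // FiniteDimensional 𝕜 L ∧ Module.finrank 𝕜 L = n}

variable {𝕜 n X}

/-- The map sending a linearly independent `n`-tuple to its linear span. -/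
def frameSpan (x : Frame 𝕜 n X) : Grassmannian 𝕜 n X :=
  ⟨Submodule.span 𝕜 (Set.range x.1),
    FiniteDimensional.span_of_finite 𝕜 (Set.finite_range x.1),
    by simpa using finrank_span_eq_card x.2⟩

theorem frameSpan_surjective : Function.Surjective (frameSpan : Frame 𝕜 n X → _) := by
  rintro ⟨L, hL, hn⟩
  let b := Module.finBasisOfFinrankEq 𝕜 L hn
  refine ⟨⟨fun i => (b i : X), ?_⟩, Subtype.ext ?_⟩
  · exact b.linearIndependent.map' L.subtype (Submodule.ker_subtype L)
  · change Submodule.span 𝕜 (Set.range fun i => (b i : X)) = L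
    have h : (Set.range fun i => (b i : X)) = L.subtype '' Set.range b := by
      rw [← Set.range_comp]; rfl
    rw [h, ← Submodule.map_span, b.span_eq, Submodule.map_top, Submodule.range_subtype]

variable [TopologicalSpace X]

/-- The quotient topology for `frameSpan`. It is the only topology for which the surjection
`frameSpan` is continuous and open (see `isOpenQuotientMap_frameSpan`). -/
instance : TopologicalSpace (Grassmannian 𝕜 n X) :=
  TopologicalSpace.coinduced frameSpan inferInstance

/-- `frameSpan` is surjective, continuous and open. -/
theorem isOpenQuotientMap_frameSpan [IsTopologicalAddGroup X] [ContinuousSMul 𝕜 X] :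
    IsOpenQuotientMap (frameSpan : Frame 𝕜 n X → Grassmannian 𝕜 n X) := by
  refine ⟨frameSpan_surjective, continuous_coinduced_rng, fun U hU => ?_⟩
  change IsOpen (frameSpan ⁻¹' (frameSpan '' U))
  rw [isOpen_iff_forall_mem_open]
  rintro x ⟨u, huU, hux⟩
  have hspan : Submodule.span 𝕜 (Set.range u.1) = Submodule.span 𝕜 (Set.range x.1) :=
    congrArg Subtype.val hux
  -- the change of frame from `x` to `u`, as an automorphism of `𝕜 ^ n`
  let bx := Module.Basis.span x.2
  let bu := (Module.Basis.span u.2).map (LinearEquiv.ofEq _ _ hspan)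
  let e : (Fin n → 𝕜) ≃ₗ[𝕜] (Fin n → 𝕜) := bu.equivFun.symm.trans bx.equivFun
  have hlc : ∀ y : Fin n → X, ∀ c, Fintype.linearCombination 𝕜
      (fun i => Fintype.linearCombination 𝕜 y (e (Pi.single i 1))) c =
        Fintype.linearCombination 𝕜 y (e c) := by
    intro y c
    have hc : c = ∑ i, c i • (Pi.single i 1 : Fin n → 𝕜) := by
      funext j
      simp [Finset.sum_apply, Pi.single_apply]
    conv_rhs => rw [hc, map_sum, map_sum]
    rw [Fintype.linearCombination_apply]
    exact Finset.sum_congr rfl fun i _ => by rw [map_smul, map_smul]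
  have hinj : ∀ y : Frame 𝕜 n X, LinearIndependent 𝕜
      (fun i => Fintype.linearCombination 𝕜 y.1 (e (Pi.single i 1))) := by
    intro y
    rw [linearIndependent_iff_injective_fintypeLinearCombination]
    have hy := linearIndependent_iff_injective_fintypeLinearCombination.1 y.2
    intro c d h
    rw [hlc, hlc] at h
    exact e.injective (hy h)
  let φ : Frame 𝕜 n X → Frame 𝕜 n X := fun y =>
    ⟨fun i => Fintype.linearCombination 𝕜 y.1 (e (Pi.single i 1)), hinj y⟩
  have hφ : Continuous φ := by
    refine Continuous.subtype_mk (continuous_pi fun i => ?_) _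
    simp only [Fintype.linearCombination_apply]
    exact continuous_finsetSum _ fun j _ =>
      ((continuous_apply j).comp continuous_subtype_val).const_smul _
  have hφs : ∀ y, frameSpan (φ y) = frameSpan y := by
    intro y
    apply Subtype.ext
    change Submodule.span 𝕜 (Set.range fun i => Fintype.linearCombination 𝕜 y.1
      (e (Pi.single i 1))) = Submodule.span 𝕜 (Set.range y.1)
    rw [← Fintype.range_linearCombination, ← Fintype.range_linearCombination]
    ext v
    simp only [LinearMap.mem_range, hlc]
    exact ⟨fun ⟨c, h⟩ => ⟨e c, h⟩, fun ⟨c, h⟩ => ⟨e.symm c, by simpa using h⟩⟩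
  have hφx : φ x = u := by
    apply Subtype.ext
    funext i
    change Fintype.linearCombination 𝕜 x.1 (e (Pi.single i 1)) = u.1 i
    have h1 : e (Pi.single i 1) = bx.equivFun (bu i) := by simp [e]
    have h2 : ∀ v, Fintype.linearCombination 𝕜 x.1 (bx.equivFun v) = (v : X) := by
      intro v
      conv_rhs => rw [← bx.sum_equivFun v]
      simp [Fintype.linearCombination_apply, bx, Module.Basis.span_apply]
    rw [h1, h2]
    simp [bu, Module.Basis.span_apply]
  refine ⟨φ ⁻¹' U, fun y hy => ⟨φ y, hy, hφs y⟩, hU.preimage hφ, ?_⟩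
  change φ x ∈ U
  rwa [hφx]

end Grassmannian

section Operators

variable {𝕜 : Type*} [NontriviallyNormedField 𝕜]
  {X : Type*} [AddCommGroup X] [TopologicalSpace X] [Module 𝕜 X]

/-- `T` is hypercyclic: some vector has a dense orbit. -/
def IsHypercyclic (T : X →L[𝕜] X) : Prop :=
  ∃ x : X, Dense (Set.range fun k : ℕ => (T ^ k) x)

/-- `T` is supercyclic: some vector has a dense projective orbit. -/
def IsSupercyclic (T : X →L[𝕜] X) : Prop :=
  ∃ x : X, Dense (Set.range fun p : 𝕜 × ℕ => p.1 • (T ^ p.2) x)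

/-- `L` is strongly `n`-supercyclic for `T`: all the subspaces `T ^ k (L)`, `k ≥ 0`, are
`n`-dimensional and they form a dense subset of the Grassmannian of `n`-dimensional
subspaces. (The case `k = 0` says that `L` itself is `n`-dimensional.) -/
def IsStronglySupercyclicSubspace (n : ℕ) (T : X →L[𝕜] X) (L : Submodule 𝕜 X) : Prop :=
  (∀ k : ℕ, FiniteDimensional 𝕜 (L.map (T ^ k).toLinearMap) ∧
      Module.finrank 𝕜 (L.map (T ^ k).toLinearMap) = n) ∧
    Dense {M : Grassmannian 𝕜 n X | ∃ k : ℕ, M.1 = L.map (T ^ k).toLinearMap}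

/-- `T` is strongly `n`-supercyclic: it has a strongly `n`-supercyclic subspace. -/
def IsStronglySupercyclic (n : ℕ) (T : X →L[𝕜] X) : Prop :=
  ∃ L : Submodule 𝕜 X, IsStronglySupercyclicSubspace n T L

end Operators

end LinDyn

/-! If no circle about the origin meets every component of `σ(T)`, some circle `|z| = r` separates
two nonempty relatively clopen pieces of the spectrum. Let `p` and `q` be the spectral idempotents
of the inner and outer pieces. `T ^ k` grows at most like `r ^ k` on the range of `p`, and its
inverse on the range of `q` is at most of order `r ^ (-k)`, so the product of the two norms is
bounded in `k` (`exists_spectral_idempotents`).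

This domination forces `q` to have rank one (`not_linearIndependent_pair`). Otherwise density makes
`q` injective on some `T ^ k (L)`, hence on `L`. Then `‖p y‖ ≤ C ‖q y‖` on all the `T ^ k (L)`,
which therefore stay away from planes containing a nonzero vector of the range of `p`.

So `T` is a nonzero scalar on the line `range q`, and `ker q` is an invariant hyperplane. Each `T ^
k (L)` not contained in it meets it in the line spanned by `T ^ k y`, with `y ≠ 0` in `L ∩ ker q`;
density of the planes makes `y` a supercyclic vector (`isSupercyclic_restrict`).

The idempotents are area integrals of the resolvent against `∂̄φ`, with `φ` a cutoff equal to `1`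
near the spectral piece; they play the role of contour integrals. -/

open Complex MeasureTheory Set Filter Topology

/-! ### Integration by parts for the `∂̄`-operator -/

section Dbar

variable {E : Type*} [NormedAddCommGroup E] [NormedSpace ℂ E]

theorem integrable_smul_of_continuousAt {f : ℂ → ℂ} {g : ℂ → E} (hf : Continuous f)
    (hc : HasCompactSupport f) (hg : ∀ z ∈ tsupport f, ContinuousAt g z) :
    Integrable (fun z => f z • g z) := by
  refine Continuous.integrable_of_hasCompactSupport (continuous_of_tsupport fun z hz => ?_)
    hc.smul_right
  exact hf.continuousAt.smul (hg z (tsupport_smul_subset_left f g hz))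

/-- Twice the `∂̄`-derivative of a function of a complex variable. -/
noncomputable def dbar (φ : ℂ → ℂ) (z : ℂ) : ℂ := fderiv ℝ φ z 1 + I * fderiv ℝ φ z I

theorem tsupport_dbar_subset (φ : ℂ → ℂ) : tsupport (dbar φ) ⊆ tsupport φ := by
  refine closure_minimal (fun z hz => ?_) (isClosed_tsupport φ)
  by_contra h
  have h0 : fderiv ℝ φ z = 0 := by
    by_contra h1
    exact h (support_fderiv_subset ℝ h1)
  exact hz (by simp [dbar, h0])

theorem continuous_dbar {φ : ℂ → ℂ} (hφ : ContDiff ℝ 1 φ) : Continuous (dbar φ) := by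
  have h := hφ.continuous_fderiv one_ne_zero
  unfold dbar
  fun_prop

theorem HasCompactSupport.dbar {φ : ℂ → ℂ} (hc : HasCompactSupport φ) :
    HasCompactSupport (dbar φ) :=
  hc.of_isClosed_subset (isClosed_tsupport _) (tsupport_dbar_subset φ)

theorem dbar_eq_zero_of_eventuallyEq_const {φ : ℂ → ℂ} {z c : ℂ} (h : φ =ᶠ[𝓝 z] fun _ => c) :
    dbar φ z = 0 := by
  simp [dbar, h.fderiv_eq]

theorem notMem_tsupport_dbar {φ : ℂ → ℂ} {z c : ℂ} (h : φ =ᶠ[𝓝 z] fun _ => c) :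
    z ∉ tsupport (dbar φ) := by
  rw [notMem_tsupport_iff_eventuallyEq]
  filter_upwards [h.eventuallyEq_nhds] with w hw using dbar_eq_zero_of_eventuallyEq_const hw

theorem dbar_sub {φ ψ : ℂ → ℂ} (hφ : ContDiff ℝ 1 φ) (hψ : ContDiff ℝ 1 ψ) (z : ℂ) :
    dbar (fun w => φ w - ψ w) z = dbar φ z - dbar ψ z := by
  have h1 := (hφ.differentiable one_ne_zero) z
  have h2 := (hψ.differentiable one_ne_zero) z
  simp only [dbar, fderiv_fun_sub h1 h2, sub_apply]
  ring

/-- Integration by parts moves the derivative onto `g`, whose derivative in direction `v` is `v •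
g'`. The directions `1` and `I` then contribute opposite multiples of `∫ φ g'`, since `I * I = -1`.
-/
theorem integral_dbar_smul_eq_zero [CompleteSpace E] {φ : ℂ → ℂ} {g : ℂ → E} {Ω : Set ℂ}
    (hφ : ContDiff ℝ 1 φ) (hc : HasCompactSupport φ) (hΩ : IsOpen Ω)
    (hg : DifferentiableOn ℂ g Ω) (hs : tsupport φ ⊆ Ω) :
    ∫ z, dbar φ z • g z = 0 := by
  have hgd : ∀ z ∈ tsupport φ, DifferentiableAt ℂ g z := fun z hz =>
    (hg z (hs hz)).differentiableAt (hΩ.mem_nhds (hs hz))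
  have hfd : ∀ z ∈ tsupport φ, ∀ v, fderiv ℝ g z v = v • deriv g z := fun z hz v => by
    rw [((hgd z hz).hasDerivAt.hasFDerivAt.restrictScalars ℝ).fderiv]
    simp
  have hderiv : ∀ z ∈ tsupport φ, ContinuousAt (deriv g) z := fun z hz =>
    ((hg.deriv hΩ) z (hs hz)).continuousWithinAt.continuousAt (hΩ.mem_nhds (hs hz))
  have hcφ := hφ.continuous_fderiv one_ne_zero
  have key : ∀ v : ℂ, (Integrable fun z => fderiv ℝ φ z v • g z) ∧
      ∫ z, fderiv ℝ φ z v • g z = - v • ∫ z, φ z • deriv g z := by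
    intro v
    have hsub : tsupport (fun z => fderiv ℝ φ z v) ⊆ tsupport φ := by
      refine closure_minimal (fun z hz => ?_) (isClosed_tsupport φ)
      apply support_fderiv_subset ℝ
      intro h0
      exact hz (by simp [h0])
    have i1 : Integrable fun z => fderiv ℝ φ z v • g z := by
      refine integrable_smul_of_continuousAt (by fun_prop)
        (hc.of_isClosed_subset (isClosed_tsupport _) hsub) fun z hz => ?_
      exact (hgd z (hsub hz)).continuousAt
    have he : ∀ z, φ z • fderiv ℝ g z v = v • (φ z • deriv g z) := by
      intro z
      by_cases hz : z ∈ tsupport φ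
      · rw [hfd z hz, smul_comm]
      · simp [image_eq_zero_of_notMem_tsupport hz]
    have i3 : Integrable fun z => φ z • deriv g z :=
      integrable_smul_of_continuousAt hφ.continuous hc hderiv
    have i2 : Integrable fun z => φ z • fderiv ℝ g z v := by
      simp_rw [he]
      exact i3.smul v
    have i4 : Integrable fun z => φ z • g z :=
      integrable_smul_of_continuousAt hφ.continuous hc fun z hz => (hgd z hz).continuousAt
    have h := integral_smul_fderiv_eq_neg_fderiv_smul_of_integrable i1 i2 i4
      (fun z _ => (hφ.differentiable one_ne_zero) z)
      (fun z hz => (hgd z hz).restrictScalars ℝ)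
    refine ⟨i1, ?_⟩
    rw [← neg_eq_iff_eq_neg.2 h]
    simp_rw [he]
    rw [integral_smul, neg_smul]
  obtain ⟨j1, e1⟩ := key 1
  obtain ⟨jI, eI⟩ := key I
  have : ∀ z, dbar φ z • g z = fderiv ℝ φ z 1 • g z + I • (fderiv ℝ φ z I • g z) := by
    intro z
    rw [dbar, add_smul, mul_smul]
  simp_rw [this]
  have jI' : Integrable fun z => I • (fderiv ℝ φ z I • g z) := jI.smul I
  rw [integral_add j1 jI', integral_smul, e1, eI, smul_smul]
  simp

end Dbar

/-! ### The Cauchy–Pompeiu formula for cutoffs, up to a nonzero constant -/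

section CauchyConstant

/-- A smooth radial bump function. -/
noncomputable def radialBump (w : ℂ) : ℂ := (Real.smoothTransition (2 - ‖w‖ ^ 2) : ℝ)

theorem contDiff_radialBump : ContDiff ℝ 1 radialBump := by
  have h : ContDiff ℝ 1 fun w : ℂ => Real.smoothTransition (2 - ‖w‖ ^ 2) :=
    Real.smoothTransition.contDiff.comp (contDiff_const.sub (contDiff_norm_sq ℝ))
  exact ofRealCLM.contDiff.comp h

theorem hasCompactSupport_radialBump : HasCompactSupport radialBump := by
  refine HasCompactSupport.intro (isCompact_closedBall 0 2) fun w hw => ?_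
  have hw' : 2 < ‖w‖ := by simpa using hw
  have : (2 : ℝ) - ‖w‖ ^ 2 ≤ 0 := by nlinarith
  simp [radialBump, Real.smoothTransition.zero_of_nonpos this]

theorem radialBump_eventuallyEq_one : radialBump =ᶠ[𝓝 0] fun _ => 1 := by
  filter_upwards [Metric.ball_mem_nhds (0 : ℂ) one_pos] with w hw
  have hw' : ‖w‖ < 1 := by simpa using hw
  have : (1 : ℝ) ≤ 2 - ‖w‖ ^ 2 := by nlinarith [norm_nonneg w]
  simp [radialBump, Real.smoothTransition.one_of_one_le this]

/-- For a radial function `∂̄` produces a factor `w`, which cancels the Cauchy kernel and leaves a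
real density of constant sign. -/
theorem dbar_radialBump (w : ℂ) :
    dbar radialBump w = (-2 * deriv Real.smoothTransition (2 - ‖w‖ ^ 2) : ℝ) * w := by
  have hd : HasDerivAt Real.smoothTransition (deriv Real.smoothTransition (2 - ‖w‖ ^ 2))
      (2 - ‖w‖ ^ 2) :=
    ((Real.smoothTransition.contDiff (n := 1)).differentiable one_ne_zero _).hasDerivAt
  have h1 : HasFDerivAt (fun w : ℂ => 2 - ‖w‖ ^ 2) (-(2 • innerSL ℝ w)) w :=
    (hasStrictFDerivAt_norm_sq w).hasFDerivAt.const_sub 2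
  have h2 := ofRealCLM.hasFDerivAt.comp w (hd.comp_hasFDerivAt w h1)
  have h3 : fderiv ℝ radialBump w = _ := h2.fderiv
  set d := deriv Real.smoothTransition (2 - ‖w‖ ^ 2)
  simp only [dbar, h3]
  apply Complex.ext <;> simp [Complex.inner] <;> ring

/-- The constant of the Cauchy–Pompeiu formula (in the normalisation of `dbar`). -/
noncomputable def cauchyConst : ℂ := ∫ w, dbar radialBump w • w⁻¹

theorem cauchyConst_ne_zero : cauchyConst ≠ 0 := by
  set F : ℂ → ℝ := fun w => 2 * deriv Real.smoothTransition (2 - ‖w‖ ^ 2) with hF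
  have hdc : Continuous (deriv Real.smoothTransition) :=
    (Real.smoothTransition.contDiff (n := 1)).continuous_deriv le_rfl
  have hFc : Continuous F := by fun_prop
  have hF0 : 0 ≤ F := fun w =>
    mul_nonneg two_pos.le Real.smoothTransition.monotone.deriv_nonneg
  have hFs : HasCompactSupport F := by
    refine HasCompactSupport.intro (isCompact_closedBall 0 2) fun w hw => ?_
    have hw' : 2 < ‖w‖ := by simpa using hw
    have h0 : (2 : ℝ) - ‖w‖ ^ 2 < 0 := by nlinarith
    have : Real.smoothTransition =ᶠ[𝓝 (2 - ‖w‖ ^ 2)] fun _ => 0 := by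
      filter_upwards [Iio_mem_nhds h0] with t ht
        using Real.smoothTransition.zero_of_nonpos (le_of_lt ht)
    simp [hF, this.deriv_eq]
  -- The mean value theorem gives a point of slope `1`; a `w` with `2 - ‖w‖ ^ 2 = t` then shows that
  -- `F` is not identically zero.
  obtain ⟨t, ht, hd⟩ := exists_deriv_eq_slope Real.smoothTransition one_pos
    Real.smoothTransition.continuous.continuousOn
    ((Real.smoothTransition.contDiff (n := 1)).differentiable one_ne_zero).differentiableOn
  have hne : F (Real.sqrt (2 - t) : ℝ) ≠ 0 := by
    have h2 : (0 : ℝ) ≤ 2 - t := by linarith [ht.2]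
    have h1 : ‖((Real.sqrt (2 - t) : ℝ) : ℂ)‖ ^ 2 = 2 - t := by
      rw [norm_real, Real.norm_eq_abs, sq_abs, Real.sq_sqrt h2]
    simp only [hF]
    rw [h1, sub_sub_cancel, hd]
    simp
  have hpos : 0 < ∫ w, F w :=
    hFc.integral_pos_of_hasCompactSupport_nonneg_nonzero hFs hF0 hne
  have : cauchyConst = -((∫ w, F w : ℝ) : ℂ) := by
    rw [cauchyConst, ← integral_complex_ofReal, ← integral_neg]
    refine integral_congr_ae ?_
    filter_upwards [(measure_singleton (0 : ℂ) : volume {(0 : ℂ)} = 0) |> compl_mem_ae_iff.2]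
      with w hw
    have hw : w ≠ 0 := hw
    rw [dbar_radialBump, smul_eq_mul, mul_assoc, mul_inv_cancel₀ hw]
    simp [hF]
  rw [this, neg_ne_zero, ofReal_ne_zero]
  exact hpos.ne'

/-- Two cutoffs equal to `1` near `ζ` differ by a function supported where the kernel is
holomorphic, so they give the same integral; the translated `radialBump` serves as reference. -/
theorem integral_dbar_smul_inv_sub {ψ : ℂ → ℂ} {ζ : ℂ} (hψ : ContDiff ℝ 1 ψ)
    (hc : HasCompactSupport ψ) (h1 : ψ =ᶠ[𝓝 ζ] fun _ => 1) :
    ∫ w, dbar ψ w • (w - ζ)⁻¹ = cauchyConst := by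
  set β : ℂ → ℂ := fun w => radialBump (w - ζ) with hβ
  have hβd : ContDiff ℝ 1 β := contDiff_radialBump.comp (contDiff_id.sub contDiff_const)
  have hβc : HasCompactSupport β :=
    hasCompactSupport_radialBump.comp_homeomorph (Homeomorph.subRight ζ)
  have hβ1 : β =ᶠ[𝓝 ζ] fun _ => 1 := by
    have : Tendsto (fun w => w - ζ) (𝓝 ζ) (𝓝 0) := by
      have h : Continuous fun w : ℂ => w - ζ := by fun_prop
      simpa using h.tendsto ζ
    exact this.eventually radialBump_eventuallyEq_one
  have hβi : ∫ w, dbar β w • (w - ζ)⁻¹ = cauchyConst := by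
    have : ∀ w, dbar β w = dbar radialBump (w - ζ) := by
      intro w
      simp only [dbar, hβ, fderiv_comp_sub]
    simp_rw [this]
    exact integral_sub_right_eq_self (fun w => dbar radialBump w • w⁻¹) ζ
  have hint : ∀ φ : ℂ → ℂ, ContDiff ℝ 1 φ → HasCompactSupport φ → φ =ᶠ[𝓝 ζ] (fun _ => 1) →
      Integrable fun w => dbar φ w • (w - ζ)⁻¹ := by
    intro φ hφ hφc hφ1
    refine integrable_smul_of_continuousAt (continuous_dbar hφ) hφc.dbar fun w hw => ?_
    have hne : w - ζ ≠ 0 := by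
      rintro h
      rw [sub_eq_zero.1 h] at hw
      exact notMem_tsupport_dbar hφ1 hw
    exact ContinuousAt.inv₀ (by fun_prop) hne
  rw [← hβi, ← sub_eq_zero, ← integral_sub (hint ψ hψ hc h1) (hint β hβd hβc hβ1)]
  simp_rw [← sub_smul, ← dbar_sub hψ hβd]
  refine integral_dbar_smul_eq_zero (Ω := {ζ}ᶜ) (hψ.sub hβd) (hc.sub hβc)
    isClosed_singleton.isOpen_compl ?_ ?_
  · refine DifferentiableOn.inv (by fun_prop) fun w hw => sub_ne_zero.2 hw
  · intro w hw hwz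
    rw [mem_singleton_iff.1 hwz] at hw
    refine notMem_tsupport_iff_eventuallyEq.2 ?_ hw
    filter_upwards [h1, hβ1] with u hu hv
    simp [hu, hv]

theorem integral_dbar_smul_inv_sub_eq_zero {ψ : ℂ → ℂ} {ζ : ℂ} (hψ : ContDiff ℝ 1 ψ)
    (hc : HasCompactSupport ψ) (h0 : ζ ∉ tsupport ψ) :
    ∫ w, dbar ψ w • (w - ζ)⁻¹ = 0 := by
  refine integral_dbar_smul_eq_zero (Ω := {ζ}ᶜ) hψ hc isClosed_singleton.isOpen_compl ?_ ?_
  · refine DifferentiableOn.inv (by fun_prop) fun w hw => sub_ne_zero.2 hw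
  · rintro w hw rfl
    exact h0 hw

end CauchyConstant

/-! ### Integrals of the resolvent: a smooth functional calculus -/

section ResolventIntegral

variable {A : Type*} [NormedRing A] [NormedAlgebra ℂ A] (a : A)

/-- A continuous compactly supported density whose support avoids the spectrum of `a`. -/
structure IsResolventDensity (h : ℂ → ℂ) : Prop where
  continuous : Continuous h
  hasCompactSupport : HasCompactSupport h
  notMem : ∀ z ∈ tsupport h, z ∉ spectrum ℂ a

/-- The normalised integral of the resolvent of `a` against a density. -/
noncomputable def resolventIntegral (h : ℂ → ℂ) : A :=
  cauchyConst⁻¹ • ∫ z, h z • resolvent a z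

variable {a}

theorem mul_resolvent {z : ℂ} (hz : z ∉ spectrum ℂ a) :
    a * resolvent a z = z • resolvent a z - 1 := by
  have h := Ring.mul_inverse_cancel _ (spectrum.notMem_iff.1 hz)
  rw [sub_mul, ← Algebra.smul_def] at h
  rw [resolvent, ← h]
  abel

theorem Commute.resolvent_right {b : A} (hb : Commute b a) (z : ℂ) :
    Commute b (resolvent a z) := by
  have h : Commute b (algebraMap ℂ A z) := (Algebra.commutes z b).symm
  have h' : Commute b (algebraMap ℂ A z - a) := h.sub_right hb
  by_cases hu : IsUnit (algebraMap ℂ A z - a)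
  · obtain ⟨u, hu⟩ := hu
    rw [← hu] at h'
    rw [resolvent, ← hu, Ring.inverse_unit]
    exact h'.units_inv_right
  · rw [resolvent, Ring.inverse_non_unit _ hu]
    exact Commute.zero_right b

/-- Resolvent identity, from evaluating `resolvent a z * a * resolvent a w` in two ways. -/
theorem resolvent_mul_resolvent {z w : ℂ} (hz : z ∉ spectrum ℂ a) (hw : w ∉ spectrum ℂ a)
    (hzw : w ≠ z) :
    resolvent a z * resolvent a w = (w - z)⁻¹ • (resolvent a z - resolvent a w) := by
  have h1 : resolvent a z * (a * resolvent a w) = resolvent a z * (w • resolvent a w - 1) := by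
    rw [mul_resolvent hw]
  rw [← mul_assoc, ← ((Commute.refl a).resolvent_right z).eq, mul_resolvent hz, sub_mul,
    smul_mul_assoc, mul_sub, mul_smul_comm, one_mul, mul_one] at h1
  rw [eq_inv_smul_iff₀ (sub_ne_zero.2 hzw), sub_smul]
  rw [sub_eq_sub_iff_add_eq_add] at h1 ⊢
  exact h1.symm.trans (add_comm _ _)

theorem isResolventDensity_dbar {φ : ℂ → ℂ} (hφ : ContDiff ℝ 1 φ) (hc : HasCompactSupport φ)
    (h : ∀ z ∈ spectrum ℂ a, ∃ c, φ =ᶠ[𝓝 z] fun _ => c) : IsResolventDensity a (dbar φ) where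
  continuous := continuous_dbar hφ
  hasCompactSupport := hc.dbar
  notMem z hz hs := (h z hs).elim fun _ h => notMem_tsupport_dbar h hz

theorem IsResolventDensity.mul_of_continuousAt {h g : ℂ → ℂ} (hh : IsResolventDensity a h)
    (hg : ∀ z ∈ tsupport h, ContinuousAt g z) :
    IsResolventDensity a fun z => g z * h z where
  continuous := continuous_of_tsupport fun z hz =>
    (hg z (tsupport_mul_subset_right hz)).mul hh.continuous.continuousAt
  hasCompactSupport := hh.hasCompactSupport.mul_left
  notMem z hz := hh.notMem z (tsupport_mul_subset_right hz)

variable [CompleteSpace A]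

theorem differentiableOn_resolvent : DifferentiableOn ℂ (resolvent a) (spectrum ℂ a)ᶜ := by
  intro z hz
  exact (spectrum.hasDerivAt_resolvent_const_left (spectrum.notMem_iff.1 hz :
    z ∈ resolventSet ℂ a)).differentiableAt.differentiableWithinAt

theorem isOpen_compl_spectrum : IsOpen (spectrum ℂ a)ᶜ := (spectrum.isClosed a).isOpen_compl

theorem continuousAt_resolvent {z : ℂ} (hz : z ∉ spectrum ℂ a) :
    ContinuousAt (resolvent a) z :=
  ((differentiableOn_resolvent z hz).differentiableAt
    (isOpen_compl_spectrum.mem_nhds hz)).continuousAt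

namespace IsResolventDensity

variable {h : ℂ → ℂ} (hh : IsResolventDensity a h)

include hh

theorem integrable : Integrable fun z => h z • resolvent a z :=
  integrable_smul_of_continuousAt hh.continuous hh.hasCompactSupport fun z hz =>
    continuousAt_resolvent (hh.notMem z hz)

theorem mul_resolventIntegral :
    a * resolventIntegral a h =
      resolventIntegral a (fun z => z * h z) - (cauchyConst⁻¹ * ∫ z, h z) • 1 := by
  have hi := (hh.mul_of_continuousAt (g := fun z => z) fun z _ => continuousAt_id).integrable
  have h0 : Integrable fun z => h z • (1 : A) :=
    (hh.continuous.integrable_of_hasCompactSupport hh.hasCompactSupport).smul_const 1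
  have he : ∀ z, a * (h z • resolvent a z) = (z * h z) • resolvent a z - h z • (1 : A) := by
    intro z
    by_cases hz : z ∈ tsupport h
    · rw [mul_smul_comm, mul_resolvent (hh.notMem z hz), smul_sub, smul_smul, mul_comm]
    · simp [image_eq_zero_of_notMem_tsupport hz]
  have := (ContinuousLinearMap.mul ℂ A a).integral_comp_comm hh.integrable
  simp only [ContinuousLinearMap.mul_apply', he] at this
  rw [resolventIntegral, mul_smul_comm, ← this, integral_sub hi h0, integral_smul_const,
    smul_sub, smul_smul, resolventIntegral]

theorem commute_resolventIntegral {b : A} (hb : Commute b a) :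
    Commute b (resolventIntegral a h) := by
  have h1 := (ContinuousLinearMap.mul ℂ A b).integral_comp_comm hh.integrable
  have h2 := ((ContinuousLinearMap.mul ℂ A).flip b).integral_comp_comm hh.integrable
  simp only [ContinuousLinearMap.mul_apply', ContinuousLinearMap.flip_apply, mul_smul_comm,
    smul_mul_assoc, (hb.resolvent_right _).eq] at h1 h2
  refine Commute.smul_right ?_ _
  exact h1.symm.trans h2

theorem norm_resolventIntegral_mul_le {g : ℂ → ℂ} {C : ℝ}
    (hg : ∀ z ∈ tsupport h, ‖g z‖ ≤ C) :
    ‖resolventIntegral a fun z => g z * h z‖ ≤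
      C * (‖cauchyConst⁻¹‖ * ∫ z, ‖h z • resolvent a z‖) := by
  rw [resolventIntegral, norm_smul, mul_left_comm, ← integral_const_mul]
  refine mul_le_mul_of_nonneg_left ?_ (norm_nonneg _)
  refine norm_integral_le_of_norm_le (hh.integrable.norm.const_mul C) (ae_of_all _ fun z => ?_)
  by_cases hz : z ∈ tsupport h
  · rw [mul_smul, norm_smul]
    exact mul_le_mul_of_nonneg_right (hg z hz) (norm_nonneg _)
  · simp [image_eq_zero_of_notMem_tsupport hz]

end IsResolventDensity

/-- The scalar correction in `mul_resolventIntegral` is the integral of `g` against `∂̄φ`, which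
vanishes because `g` is holomorphic near the support of `φ`. -/
theorem mul_resolventIntegral_dbar {φ g : ℂ → ℂ} {Ω : Set ℂ} (hφ : ContDiff ℝ 1 φ)
    (hc : HasCompactSupport φ) (hd : IsResolventDensity a (dbar φ)) (hΩ : IsOpen Ω)
    (hg : DifferentiableOn ℂ g Ω) (hs : tsupport φ ⊆ Ω) :
    a * resolventIntegral a (fun z => g z * dbar φ z) =
      resolventIntegral a (fun z => z * g z * dbar φ z) := by
  have h0 := integral_dbar_smul_eq_zero hφ hc hΩ hg hs
  simp only [smul_eq_mul, mul_comm (dbar φ _)] at h0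
  rw [(hd.mul_of_continuousAt fun z hz => (hg.differentiableAt
    (hΩ.mem_nhds (hs (tsupport_dbar_subset φ hz)))).continuousAt).mul_resolventIntegral, h0]
  simp [mul_assoc]

theorem pow_mul_resolventIntegral_dbar {φ g : ℂ → ℂ} {Ω : Set ℂ} (hφ : ContDiff ℝ 1 φ)
    (hc : HasCompactSupport φ) (hd : IsResolventDensity a (dbar φ)) (hΩ : IsOpen Ω)
    (hg : DifferentiableOn ℂ g Ω) (hs : tsupport φ ⊆ Ω) (k : ℕ) :
    a ^ k * resolventIntegral a (fun z => g z * dbar φ z) =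
      resolventIntegral a (fun z => z ^ k * g z * dbar φ z) := by
  induction k with
  | zero => simp
  | succ k ih =>
    rw [pow_succ', mul_assoc, ih, mul_resolventIntegral_dbar (g := fun z => z ^ k * g z) hφ hc hd hΩ
      ((differentiableOn_id.pow k).mul hg) hs]
    simp only [pow_succ', mul_assoc]

/-- If `φ = 1` near a spectral point, then the associated resolvent integral is nonzero. -/
theorem resolventIntegral_dbar_ne_zero {φ : ℂ → ℂ} {l : ℂ} (hφ : ContDiff ℝ 1 φ)
    (hc : HasCompactSupport φ) (hd : IsResolventDensity a (dbar φ)) (hl : l ∈ spectrum ℂ a)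
    (h1 : φ =ᶠ[𝓝 l] fun _ => 1) : resolventIntegral a (dbar φ) ≠ 0 := by
  intro h0
  have hne : ∀ z ∈ tsupport (dbar φ), z - l ≠ 0 := by
    intro z hz h
    rw [sub_eq_zero.1 h] at hz
    exact notMem_tsupport_dbar h1 hz
  -- Since `z / (z - l) = 1 + l / (z - l)`, vanishing of the integral would make the integral `G` of
  -- this density satisfy `a G = l G - 1`, an inverse of `l - a`.
  have hG := hd.mul_of_continuousAt (g := fun z => (z - l)⁻¹) fun z hz =>
    ContinuousAt.inv₀ (by fun_prop) (hne z hz)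
  have h2 := integral_dbar_smul_inv_sub hφ hc h1
  simp only [smul_eq_mul, mul_comm (dbar φ _)] at h2
  have h3 := hG.mul_resolventIntegral
  have h4 : (fun z => z * ((z - l)⁻¹ * dbar φ z)) =
      fun z => l * ((z - l)⁻¹ * dbar φ z) + dbar φ z := by
    funext z
    by_cases hz : z ∈ tsupport (dbar φ)
    · have := hne z hz
      field_simp
      ring
    · simp [image_eq_zero_of_notMem_tsupport hz]
  have h5 : resolventIntegral a (fun z => l * ((z - l)⁻¹ * dbar φ z) + dbar φ z) =
      l • resolventIntegral a (fun z => (z - l)⁻¹ * dbar φ z) +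
        resolventIntegral a (dbar φ) := by
    have hi : Integrable fun z => (l * ((z - l)⁻¹ * dbar φ z)) • resolvent a z := by
      simp only [mul_smul l]
      exact hG.integrable.smul l
    simp only [resolventIntegral, add_smul]
    rw [integral_add hi hd.integrable, smul_add]
    simp only [mul_smul l]
    rw [integral_smul, smul_comm]
  rw [h4, h5, h0, h2, add_zero, inv_mul_cancel₀ cauchyConst_ne_zero, one_smul,
    Algebra.smul_def] at h3
  set G := resolventIntegral a (fun z => (z - l)⁻¹ * dbar φ z)
  have hcomm : Commute (algebraMap ℂ A l - a) G :=
    hG.commute_resolventIntegral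
      (Commute.sub_left (Algebra.commutes l a : Commute _ a) (Commute.refl a))
  have h6 : (algebraMap ℂ A l - a) * G = 1 := by
    rw [sub_mul, h3]
    abel
  exact hl ⟨⟨_, G, h6, hcomm.eq ▸ h6⟩, rfl⟩

/-- Fubini applies because disjoint supports keep the kernel continuous. For fixed `w` in the
support of `g`, the `z`-integral is a Cauchy integral at a point off the support of `f`, hence zero.
-/
theorem integral_dbar_resolvent_swap {f g : ℂ → ℂ} (hf : ContDiff ℝ 1 f)
    (hfc : HasCompactSupport f) (hg : IsResolventDensity a g)
    (hfg : Disjoint (tsupport f) (tsupport g)) :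
    ∫ z, dbar f z • ∫ w, g w • (w - z)⁻¹ • resolvent a w = 0 := by
  have hF : Continuous (Function.uncurry fun z w : ℂ =>
      (dbar f z * g w) • (w - z)⁻¹ • resolvent a w) := by
    refine continuous_of_tsupport fun p hp => ?_
    have hsub : tsupport (Function.uncurry fun z w : ℂ =>
        (dbar f z * g w) • (w - z)⁻¹ • resolvent a w) ⊆ tsupport (dbar f) ×ˢ tsupport g := by
      refine closure_minimal (fun q hq => ?_)
        ((isClosed_tsupport _).prod (isClosed_tsupport _))
      have hq' : dbar f q.1 * g q.2 ≠ 0 := fun h => hq (by simp [Function.uncurry, h])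
      exact ⟨subset_tsupport _ (left_ne_zero_of_mul hq'),
        subset_tsupport _ (right_ne_zero_of_mul hq')⟩
    obtain ⟨h1, h2⟩ := hsub hp
    have hne : p.2 - p.1 ≠ 0 := fun h =>
      disjoint_left.1 hfg (tsupport_dbar_subset f h1) (sub_eq_zero.1 h ▸ h2)
    have c1 : ContinuousAt (fun q : ℂ × ℂ => dbar f q.1 * g q.2) p :=
      (((continuous_dbar hf).comp continuous_fst).mul
        (hg.continuous.comp continuous_snd)).continuousAt
    have c2 : ContinuousAt (fun q : ℂ × ℂ => (q.2 - q.1)⁻¹) p :=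
      ContinuousAt.inv₀ (by fun_prop) hne
    have c3 : ContinuousAt (fun q : ℂ × ℂ => resolvent a q.2) p :=
      (continuousAt_resolvent (hg.notMem _ h2)).comp continuous_snd.continuousAt
    exact c1.smul (c2.smul c3)
  have hFc : HasCompactSupport (Function.uncurry fun z w : ℂ =>
      (dbar f z * g w) • (w - z)⁻¹ • resolvent a w) := by
    refine HasCompactSupport.intro (hfc.dbar.isCompact.prod hg.hasCompactSupport.isCompact)
      fun q hq => ?_
    rw [mem_prod, not_and_or] at hq
    rcases hq with h | h <;> simp [Function.uncurry, image_eq_zero_of_notMem_tsupport h]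
  have h := integral_integral_swap_of_hasCompactSupport (μ := volume) (ν := volume) hF hFc
  have e1 : ∀ z, ∫ w, (dbar f z * g w) • (w - z)⁻¹ • resolvent a w =
      dbar f z • ∫ w, g w • (w - z)⁻¹ • resolvent a w := by
    intro z
    simp only [mul_smul (dbar f z)]
    exact integral_smul _ _
  simp only [e1] at h
  rw [h]
  refine integral_eq_zero_of_ae (ae_of_all _ fun w => ?_)
  by_cases hw : w ∈ tsupport g
  · have h0 := integral_dbar_smul_inv_sub_eq_zero hf hfc
      fun h => disjoint_left.1 hfg h hw
    have : ∀ z, (dbar f z * g w) • (w - z)⁻¹ • resolvent a w =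
        (dbar f z • (z - w)⁻¹) • (-g w • resolvent a w) := by
      intro z
      rw [← neg_sub z w, inv_neg, smul_smul, smul_smul, smul_eq_mul]
      congr 1
      ring
    simp only [this]
    rw [integral_smul_const, h0, zero_smul]
    rfl
  · simp [image_eq_zero_of_notMem_tsupport hw]

/-- The resolvent identity splits the double integral in two: one half factors through the constant
`c`, the other vanishes by `integral_dbar_resolvent_swap`. -/
theorem resolventIntegral_mul_resolventIntegral {f g : ℂ → ℂ} {c : ℂ} (hf : ContDiff ℝ 1 f)
    (hfc : HasCompactSupport f) (hfd : IsResolventDensity a (dbar f))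
    (hg : IsResolventDensity a g) (hfg : Disjoint (tsupport f) (tsupport g))
    (hc : ∀ z ∈ tsupport f, ∫ w, g w • (w - z)⁻¹ = c) :
    resolventIntegral a (dbar f) * resolventIntegral a g =
      (cauchyConst⁻¹ * c) • resolventIntegral a (dbar f) := by
  have hne : ∀ z ∈ tsupport f, ∀ w ∈ tsupport g, w - z ≠ 0 := fun z hz w hw h =>
    disjoint_left.1 hfg hz (sub_eq_zero.1 h ▸ hw)
  have hci : ∀ z ∈ tsupport f, ∀ w ∈ tsupport g, ContinuousAt (fun w => (w - z)⁻¹) w :=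
    fun z hz w hw => ContinuousAt.inv₀ (by fun_prop) (hne z hz w hw)
  have key : ∀ z, dbar f z • (resolvent a z * ∫ w, g w • resolvent a w) =
      c • (dbar f z • resolvent a z) -
        dbar f z • ∫ w, g w • (w - z)⁻¹ • resolvent a w := by
    intro z
    by_cases hz : z ∈ tsupport (dbar f)
    · have hz' := tsupport_dbar_subset f hz
      have h1 := (ContinuousLinearMap.mul ℂ A (resolvent a z)).integral_comp_comm hg.integrable
      simp only [ContinuousLinearMap.mul_apply', mul_smul_comm] at h1
      rw [← h1, smul_comm c, ← smul_sub, ← hc z hz', ← integral_smul_const]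
      congr 1
      rw [← integral_sub]
      · refine integral_congr_ae (ae_of_all _ fun w => ?_)
        by_cases hw : w ∈ tsupport g
        · simp only
          rw [resolvent_mul_resolvent (hfd.notMem z hz) (hg.notMem w hw)
            (sub_ne_zero.1 (hne z hz' w hw)), smul_sub, smul_sub, smul_smul, smul_eq_mul]
        · simp [image_eq_zero_of_notMem_tsupport hw]
      · exact (integrable_smul_of_continuousAt hg.continuous hg.hasCompactSupport
          (hci z hz')).smul_const _
      · exact integrable_smul_of_continuousAt hg.continuous hg.hasCompactSupport fun w hw =>
          (hci z hz' w hw).smul (continuousAt_resolvent (hg.notMem w hw))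
    · simp [image_eq_zero_of_notMem_tsupport hz]
  have h2 := ((ContinuousLinearMap.mul ℂ A).flip
    (∫ w, g w • resolvent a w)).integral_comp_comm hfd.integrable
  simp only [ContinuousLinearMap.mul_apply', ContinuousLinearMap.flip_apply,
    smul_mul_assoc, key] at h2
  have hi1 : Integrable fun z => c • (dbar f z • resolvent a z) := hfd.integrable.smul c
  have hi2 : Integrable fun z => dbar f z • ∫ w, g w • (w - z)⁻¹ • resolvent a w := by
    have hi3 : Integrable fun z =>
        (dbar f z • resolvent a z) * ∫ w, g w • resolvent a w :=
      hfd.integrable.mul_const _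
    have := hi1.sub hi3
    refine this.congr (ae_of_all _ fun z => ?_)
    simp only [Pi.sub_apply, smul_mul_assoc, key]
    abel
  rw [integral_sub hi1 hi2, integral_dbar_resolvent_swap hf hfc hg hfg, sub_zero,
    integral_smul] at h2
  rw [resolventIntegral, resolventIntegral, smul_mul_smul_comm, ← h2, smul_smul, smul_smul]
  congr 1
  ring

end ResolventIntegral

/-! ### Riesz idempotents -/

section RieszProjection

theorem exists_cutoff {K U : Set ℂ} (hK : IsCompact K) (hU : IsOpen U) (hKU : K ⊆ U) :
    ∃ φ : ℂ → ℂ, ContDiff ℝ 1 φ ∧ HasCompactSupport φ ∧ tsupport φ ⊆ U ∧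
      ∀ z ∈ K, φ =ᶠ[𝓝 z] fun _ => 1 := by
  obtain ⟨L, hL, hKL, hLU⟩ := exists_compact_between hK hU hKU
  obtain ⟨f, hf1, hf0, -⟩ := exists_contMDiffMap_one_nhds_of_subset_interior
    (n := 1) (modelWithCornersSelf ℝ ℂ) hK.isClosed hKL
  have hs : tsupport (fun z => (f z : ℂ)) ⊆ L := by
    refine closure_minimal (fun z hz => ?_) hL.isClosed
    by_contra h
    exact hz (by simp [hf0 z h])
  refine ⟨fun z => (f z : ℂ), ofRealCLM.contDiff.comp f.contMDiff.contDiff,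
    hL.of_isClosed_subset (isClosed_tsupport _) hs, hs.trans hLU, fun z hz => ?_⟩
  filter_upwards [eventually_nhdsSet_iff_forall.1 hf1 z hz] with w hw
  simp [hw]

variable {A : Type*} [NormedRing A] [NormedAlgebra ℂ A] [CompleteSpace A] {a : A}

/-- A second cutoff `ψ`, equal to `1` near the support of `φ`, gives the same element because `ψ -
φ` vanishes near the spectrum. As `∂̄ψ` is supported off the support of `φ`, the product formula
applies with `c = cauchyConst`. -/
theorem exists_cutoff_isIdempotentElem {U : Set ℂ} (hU : IsOpen U)
    (hK : IsCompact (U ∩ spectrum ℂ a)) :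
    ∃ φ : ℂ → ℂ, ContDiff ℝ 1 φ ∧ HasCompactSupport φ ∧ tsupport φ ⊆ U ∧
      IsResolventDensity a (dbar φ) ∧ (∀ z ∈ U ∩ spectrum ℂ a, φ =ᶠ[𝓝 z] fun _ => 1) ∧
      IsIdempotentElem (resolventIntegral a (dbar φ)) := by
  have hdens : ∀ φ : ℂ → ℂ, ContDiff ℝ 1 φ → HasCompactSupport φ → tsupport φ ⊆ U →
      (∀ z ∈ U ∩ spectrum ℂ a, φ =ᶠ[𝓝 z] fun _ => 1) → IsResolventDensity a (dbar φ) := by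
    intro φ hφ hφc hφU hφ1
    refine isResolventDensity_dbar hφ hφc fun z hz => ?_
    by_cases hzU : z ∈ U
    · exact ⟨1, hφ1 z ⟨hzU, hz⟩⟩
    · exact ⟨0, notMem_tsupport_iff_eventuallyEq.1 fun h => hzU (hφU h)⟩
  obtain ⟨φ, hφ, hφc, hφU, hφ1⟩ := exists_cutoff hK hU inter_subset_left
  obtain ⟨ψ, hψ, hψc, hψU, hψφ⟩ := exists_cutoff hφc.isCompact hU hφU
  have hmem : ∀ z ∈ U ∩ spectrum ℂ a, z ∈ tsupport φ := by
    intro z hz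
    by_contra h
    exact one_ne_zero ((hφ1 z hz).eq_of_nhds.symm.trans (image_eq_zero_of_notMem_tsupport h))
  have hψ1 : ∀ z ∈ U ∩ spectrum ℂ a, ψ =ᶠ[𝓝 z] fun _ => 1 := fun z hz => hψφ z (hmem z hz)
  have hφd := hdens φ hφ hφc hφU hφ1
  have hψd := hdens ψ hψ hψc hψU hψ1
  refine ⟨φ, hφ, hφc, hφU, hφd, hφ1, ?_⟩
  have heq : resolventIntegral a (dbar ψ) = resolventIntegral a (dbar φ) := by
    rw [resolventIntegral, resolventIntegral, ← sub_eq_zero, ← smul_sub,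
      ← integral_sub hψd.integrable hφd.integrable]
    simp_rw [← sub_smul, ← dbar_sub hψ hφ]
    rw [integral_dbar_smul_eq_zero (hψ.sub hφ) (hψc.sub hφc) isOpen_compl_spectrum
      differentiableOn_resolvent, smul_zero]
    intro z hz hzs
    refine notMem_tsupport_iff_eventuallyEq.2 ?_ hz
    by_cases hzU : z ∈ U
    · filter_upwards [hφ1 z ⟨hzU, hzs⟩, hψ1 z ⟨hzU, hzs⟩] with w h1 h2
      simp [h1, h2]
    · filter_upwards [notMem_tsupport_iff_eventuallyEq.1 fun h => hzU (hφU h),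
        notMem_tsupport_iff_eventuallyEq.1 fun h => hzU (hψU h)] with w h1 h2
      simp [h1, h2]
  have hmul := resolventIntegral_mul_resolventIntegral hφ hφc hφd hψd
    (disjoint_left.2 fun z hz => notMem_tsupport_dbar (hψφ z hz))
    fun z hz => integral_dbar_smul_inv_sub hψ hψc (hψφ z hz)
  rwa [heq, inv_mul_cancel₀ cauchyConst_ne_zero, one_smul] at hmul

/-- Spectral idempotents of two relatively clopen parts of the spectrum which are separated by
a circle centred at the origin. -/
theorem exists_spectral_idempotents {r : ℝ} (hr : 0 < r) {U V : Set ℂ} (hU : IsOpen U)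
    (hV : IsOpen V) (hUr : ∀ z ∈ U, ‖z‖ < r) (hVr : ∀ z ∈ V, r < ‖z‖)
    (hUc : IsCompact (U ∩ spectrum ℂ a)) (hVc : IsCompact (V ∩ spectrum ℂ a))
    (hUn : (U ∩ spectrum ℂ a).Nonempty) (hVn : (V ∩ spectrum ℂ a).Nonempty) :
    ∃ (p q : A) (s : ℕ → A) (N : ℝ), IsIdempotentElem p ∧ IsIdempotentElem q ∧ q * p = 0 ∧
      p ≠ 0 ∧ q ≠ 0 ∧ Commute a p ∧ Commute a q ∧ (∀ k, s k * a ^ k = q) ∧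
      ∀ k, ‖a ^ k * p‖ * ‖s k‖ ≤ N := by
  obtain ⟨φ, hφ, hφc, hφU, hφd, hφ1, hp⟩ := exists_cutoff_isIdempotentElem hU hUc
  obtain ⟨ψ, hψ, hψc, hψV, hψd, hψ1, hq⟩ := exists_cutoff_isIdempotentElem hV hVc
  have hdisj : Disjoint (tsupport ψ) (tsupport φ) := disjoint_left.2 fun z hz hz' =>
    lt_asymm (hUr z (hφU hz')) (hVr z (hψV hz))
  have h0 : ∀ z ∈ V, z ≠ 0 := by
    rintro z hz rfl
    simpa using hr.trans (hVr 0 hz)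
  have hinv : ∀ k : ℕ, DifferentiableOn ℂ (fun z => (z ^ k)⁻¹) V := fun k =>
    DifferentiableOn.inv (by fun_prop) fun z hz => pow_ne_zero k (h0 z hz)
  -- These densities define `s k`, the function `z ^ (-k)` of `a` on the outer piece; it is
  -- holomorphic there as `0 ∉ V`.
  have hsd : ∀ k : ℕ, IsResolventDensity a fun z => (z ^ k)⁻¹ * dbar ψ z := fun k =>
    hψd.mul_of_continuousAt fun z hz => ((hinv k).differentiableAt
      (hV.mem_nhds (hψV (tsupport_dbar_subset ψ hz)))).continuousAt
  set M₁ := ‖cauchyConst⁻¹‖ * ∫ z, ‖dbar φ z • resolvent a z‖ with hM₁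
  set M₂ := ‖cauchyConst⁻¹‖ * ∫ z, ‖dbar ψ z • resolvent a z‖ with hM₂
  have hM₁0 : 0 ≤ M₁ := mul_nonneg (norm_nonneg _) (integral_nonneg fun _ => norm_nonneg _)
  have b1 : ∀ k : ℕ, ‖a ^ k * resolventIntegral a (dbar φ)‖ ≤ r ^ k * M₁ := by
    intro k
    have h := pow_mul_resolventIntegral_dbar (g := fun _ => 1) hφ hφc hφd hU
      (by fun_prop) hφU k
    simp only [one_mul, mul_one] at h
    rw [h]
    refine hφd.norm_resolventIntegral_mul_le fun z hz => ?_
    rw [norm_pow]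
    exact pow_le_pow_left₀ (norm_nonneg z) (hUr z (hφU (tsupport_dbar_subset φ hz))).le k
  have b2 : ∀ k : ℕ, ‖resolventIntegral a fun z => (z ^ k)⁻¹ * dbar ψ z‖ ≤
      (r ^ k)⁻¹ * M₂ := by
    intro k
    refine hψd.norm_resolventIntegral_mul_le fun z hz => ?_
    rw [norm_inv, norm_pow]
    exact inv_anti₀ (pow_pos hr k)
      (pow_le_pow_left₀ hr.le (hVr z (hψV (tsupport_dbar_subset ψ hz))).le k)
  obtain ⟨l, hl⟩ := hUn
  obtain ⟨m, hm⟩ := hVn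
  refine ⟨resolventIntegral a (dbar φ), resolventIntegral a (dbar ψ),
    fun k => resolventIntegral a fun z => (z ^ k)⁻¹ * dbar ψ z, M₁ * M₂, hp, hq, ?_,
    resolventIntegral_dbar_ne_zero hφ hφc hφd hl.2 (hφ1 l hl),
    resolventIntegral_dbar_ne_zero hψ hψc hψd hm.2 (hψ1 m hm),
    hφd.commute_resolventIntegral (Commute.refl a),
    hψd.commute_resolventIntegral (Commute.refl a), fun k => ?_, fun k => ?_⟩
  -- Points of the support of `ψ` lie off that of `φ`, so the product formula applies with `c = 0`.
  · have := resolventIntegral_mul_resolventIntegral hψ hψc hψd hφd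
      (hdisj.mono_right (tsupport_dbar_subset φ))
      fun z hz => integral_dbar_smul_inv_sub_eq_zero hφ hφc (disjoint_left.1 hdisj hz)
    simpa using this
  · rw [← ((hsd k).commute_resolventIntegral ((Commute.refl a).pow_left k)).eq,
      pow_mul_resolventIntegral_dbar hψ hψc hψd hV (hinv k) hψV]
    congr 1
    funext z
    by_cases hz : z ∈ tsupport ψ
    · rw [mul_inv_cancel₀ (pow_ne_zero k (h0 z (hψV hz))), one_mul]
    · simp [image_eq_zero_of_notMem_tsupport fun h => hz (tsupport_dbar_subset ψ h)]
  · calc _ ≤ (r ^ k * M₁) * ((r ^ k)⁻¹ * M₂) := by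
          refine mul_le_mul (b1 k) (b2 k) (norm_nonneg _) (mul_nonneg (pow_nonneg hr.le k) hM₁0)
      _ = M₁ * M₂ := by
          have := pow_ne_zero k hr.ne'
          field_simp

end RieszProjection

/-! ### Separating components of a compact set by a circle -/

section Components

/-- In a compact Hausdorff space a component is the intersection of the clopen sets containing it;
by compactness one of them already lies in `W`. -/
theorem exists_isOpen_isCompact_inter {K W : Set ℂ} (hK : IsCompact K) (hW : IsOpen W) {z : ℂ}
    (hz : z ∈ K) (hzW : connectedComponentIn K z ⊆ W) :
    ∃ U, IsOpen U ∧ U ⊆ W ∧ z ∈ U ∧ IsCompact (U ∩ K) := by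
  have := isCompact_iff_compactSpace.1 hK
  let x : K := ⟨z, hz⟩
  have hx : connectedComponent x ⊆ Subtype.val ⁻¹' W := by
    rw [connectedComponentIn_eq_image hz] at hzW
    exact image_subset_iff.1 hzW
  rw [connectedComponent_eq_iInter_isClopen] at hx
  have : Nonempty {s : Set K // IsClopen s ∧ x ∈ s} := ⟨⟨univ, isClopen_univ, mem_univ x⟩⟩
  obtain ⟨⟨s, hs, hxs⟩, hsW⟩ := exists_subset_nhds_of_isCompact
    (V := fun s : {s : Set K // IsClopen s ∧ x ∈ s} => (s : Set K))
    (fun s t => ⟨⟨s.1 ∩ t.1, s.2.1.inter t.2.1, s.2.2, t.2.2⟩, inter_subset_left,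
      inter_subset_right⟩)
    (fun s => s.2.1.isClosed.isCompact)
    (fun y hy => (hW.preimage continuous_subtype_val).mem_nhds (hx hy))
  obtain ⟨O, hO, rfl⟩ := isOpen_induced_iff.1 hs.isOpen
  refine ⟨O ∩ W, hO.inter hW, inter_subset_right, ⟨hxs, hsW hxs⟩, ?_⟩
  have he : O ∩ W ∩ K = Subtype.val '' (Subtype.val ⁻¹' O : Set K) := by
    rw [Subtype.image_preimage_coe]
    ext w
    constructor
    · rintro ⟨⟨h1, -⟩, h3⟩
      exact ⟨h3, h1⟩
    · rintro ⟨h3, h1⟩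
      exact ⟨⟨h1, hsW (show (⟨w, h3⟩ : K) ∈ Subtype.val ⁻¹' O from h1)⟩, h3⟩
  rw [he]
  exact hs.isClosed.isCompact.image continuous_subtype_val

/-- If no circle centred at the origin meets all the components of a compact set, then some
circle separates two relatively clopen parts of this set. -/
theorem exists_circle_separating {K : Set ℂ} (hK : IsCompact K)
    (h : ¬ ∃ R : ℝ, 0 ≤ R ∧ ∀ z ∈ K, (connectedComponentIn K z ∩ {w : ℂ | ‖w‖ = R}).Nonempty) :
    ∃ r : ℝ, 0 < r ∧ ∃ U V : Set ℂ, IsOpen U ∧ IsOpen V ∧ (∀ z ∈ U, ‖z‖ < r) ∧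
      (∀ z ∈ V, r < ‖z‖) ∧ IsCompact (U ∩ K) ∧ IsCompact (V ∩ K) ∧ (U ∩ K).Nonempty ∧
      (V ∩ K).Nonempty := by
  have hC : ∀ z ∈ K, IsCompact (connectedComponentIn K z) := by
    intro z hz
    have := isCompact_iff_compactSpace.1 hK
    rw [connectedComponentIn_eq_image hz]
    exact isClosed_connectedComponent.isCompact.image continuous_subtype_val
  have hlo : ∀ z ∈ K, ∃ w ∈ connectedComponentIn K z,
      ∀ v ∈ connectedComponentIn K z, ‖w‖ ≤ ‖v‖ := fun z hz =>
    (hC z hz).exists_isMinOn ⟨z, mem_connectedComponentIn hz⟩ continuous_norm.continuousOn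
  have hhi : ∀ z ∈ K, ∃ w ∈ connectedComponentIn K z,
      ∀ v ∈ connectedComponentIn K z, ‖v‖ ≤ ‖w‖ := fun z hz =>
    (hC z hz).exists_isMaxOn ⟨z, mem_connectedComponentIn hz⟩ continuous_norm.continuousOn
  choose! lo hlo₁ hlo₂ using hlo
  choose! hi hhi₁ hhi₂ using hhi
  -- The moduli on each component fill an interval. Either two of these intervals are disjoint and a
  -- circle fits between them, or they meet pairwise and the supremum of the left endpoints belongs
  -- to all.
  by_cases hcase : ∃ z ∈ K, ∃ w ∈ K, ‖hi z‖ < ‖lo w‖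
  · obtain ⟨z, hz, w, hw, hzw⟩ := hcase
    obtain ⟨r, hr₁, hr₂⟩ := exists_between hzw
    obtain ⟨U, hU, hUr, hzU, hUc⟩ := exists_isOpen_isCompact_inter hK
      (isOpen_lt continuous_norm (continuous_const (y := r))) hz
      fun v hv => (hhi₂ z hz v hv).trans_lt hr₁
    obtain ⟨V, hV, hVr, hwV, hVc⟩ := exists_isOpen_isCompact_inter hK
      (isOpen_lt (continuous_const (y := r)) continuous_norm) hw
      fun v hv => hr₂.trans_le (hlo₂ w hw v hv)
    exact ⟨r, (norm_nonneg _).trans_lt hr₁, U, V, hU, hV, fun v hv => hUr hv,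
      fun v hv => hVr hv, hUc, hVc, ⟨z, hzU, hz⟩, ⟨w, hwV, hw⟩⟩
  · push Not at hcase
    refine absurd ?_ h
    rcases K.eq_empty_or_nonempty with rfl | ⟨z₀, hz₀⟩
    · exact ⟨0, le_rfl, fun z hz => hz.elim⟩
    have hbdd : BddAbove ((fun z => ‖lo z‖) '' K) :=
      ⟨‖hi z₀‖, forall_mem_image.2 fun z hz => hcase z₀ hz₀ z hz⟩
    refine ⟨sSup ((fun z => ‖lo z‖) '' K),
      (norm_nonneg _).trans (le_csSup hbdd (mem_image_of_mem _ hz₀)), fun z hz => ?_⟩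
    have hmem : sSup ((fun z => ‖lo z‖) '' K) ∈ Icc ‖lo z‖ ‖hi z‖ :=
      ⟨le_csSup hbdd (mem_image_of_mem _ hz),
        csSup_le ⟨_, mem_image_of_mem _ hz₀⟩ (forall_mem_image.2 fun w hw => hcase z hz w hw)⟩
    obtain ⟨v, hv, hv'⟩ := isPreconnected_connectedComponentIn.intermediate_value
      (hlo₁ z hz) (hhi₁ z hz) continuous_norm.continuousOn hmem
    exact ⟨v, hv, hv'⟩

end Components

/-! ### Dynamics on the Grassmannian -/

section Dynamics

variable {X : Type*} [NormedAddCommGroup X] [NormedSpace ℂ X]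

namespace LinDyn.IsStronglySupercyclicSubspace

variable {n : ℕ} {T : X →L[ℂ] X} {L : Submodule ℂ X}

/-- Density is used only in this form: `frameSpan` is open, so open conditions on frames can be met
by a frame of some `T ^ k (L)`. -/
theorem exists_frame_mem (hL : IsStronglySupercyclicSubspace n T L) {O : Set (Frame ℂ n X)}
    (hO : IsOpen O) (hne : O.Nonempty) :
    ∃ k : ℕ, ∃ x ∈ O, Submodule.span ℂ (range x.1) = L.map (T ^ k).toLinearMap := by
  obtain ⟨M, ⟨x, hx, rfl⟩, k, hk⟩ := hL.2.inter_open_nonempty _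
    (isOpenQuotientMap_frameSpan.isOpenMap O hO) (hne.image _)
  exact ⟨k, x, hx, hk⟩

theorem map_pow_zero (L : Submodule ℂ X) (T : X →L[ℂ] X) :
    L.map (T ^ 0).toLinearMap = L := by
  rw [pow_zero]
  exact Submodule.map_id L

theorem finiteDimensional (hL : IsStronglySupercyclicSubspace n T L) :
    FiniteDimensional ℂ L := by
  have := (hL.1 0).1
  rwa [map_pow_zero] at this

theorem finrank_eq (hL : IsStronglySupercyclicSubspace n T L) : Module.finrank ℂ L = n := by
  have := (hL.1 0).2
  rwa [map_pow_zero] at this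

/-- `T ^ k` preserves the dimension of `L`, so rank–nullity makes it injective there. -/
theorem eq_zero_of_pow_apply_eq_zero (hL : IsStronglySupercyclicSubspace n T L) {k : ℕ} {l : X}
    (hl : l ∈ L) (h : (T ^ k) l = 0) : l = 0 := by
  have := hL.finiteDimensional
  have h1 := ((T ^ k).toLinearMap.domRestrict L).finrank_range_add_finrank_ker
  rw [LinearMap.range_domRestrict, (hL.1 k).2, hL.finrank_eq, add_eq_left,
    Submodule.finrank_eq_zero] at h1
  have h2 : (⟨l, hl⟩ : L) ∈ LinearMap.ker ((T ^ k).toLinearMap.domRestrict L) := h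
  rw [h1, Submodule.mem_bot] at h2
  exact congrArg Subtype.val h2

/-- By finite dimension, `q` is bounded below on `L`. For `y = T ^ k l`, `‖p y‖` is at most `‖T ^ k
* p‖ ‖l‖`, while `q l = s k (q y)` bounds `‖l‖` by a multiple of `‖s k‖ ‖q y‖`. -/
theorem exists_bound_of_injOn (hL : IsStronglySupercyclicSubspace n T L) {p q : X →L[ℂ] X}
    {s : ℕ → X →L[ℂ] X} {N : ℝ} (hq : IsIdempotentElem q) (hTp : Commute T p)
    (hTq : Commute T q) (hs : ∀ k, s k * T ^ k = q) (hN : ∀ k, ‖T ^ k * p‖ * ‖s k‖ ≤ N)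
    (hinj : ∀ l ∈ L, q l = 0 → l = 0) :
    ∃ C : ℝ, ∀ k : ℕ, ∀ y ∈ L.map (T ^ k).toLinearMap, ‖p y‖ ≤ C * ‖q y‖ := by
  have := hL.finiteDimensional
  obtain ⟨K, -, hK⟩ := (q.toLinearMap.domRestrict L).exists_antilipschitzWith
    (LinearMap.ker_eq_bot'.2 fun l hl => Subtype.ext (hinj l l.2 hl))
  refine ⟨N * K, fun k y hy => ?_⟩
  obtain ⟨l, hl, rfl⟩ := hy
  have h1 : ‖l‖ ≤ K * ‖q l‖ := by
    simpa using hK.le_mul_dist ⟨l, hl⟩ 0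
  have h2 : q l = s k (q ((T ^ k) l)) := by
    have : q = s k * (q * T ^ k) := by
      rw [← (hTq.pow_left k).eq, ← mul_assoc, hs, hq.eq]
    exact congrArg (fun f : X →L[ℂ] X => f l) this
  have h3 : p ((T ^ k) l) = (T ^ k * p) l :=
    congrArg (fun f : X →L[ℂ] X => f l) (hTp.pow_left k).eq.symm
  calc ‖p ((T ^ k) l)‖ = ‖(T ^ k * p) l‖ := by rw [h3]
    _ ≤ ‖T ^ k * p‖ * ‖l‖ := ContinuousLinearMap.le_opNorm _ _
    _ ≤ ‖T ^ k * p‖ * (K * (‖s k‖ * ‖q ((T ^ k) l)‖)) := by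
        refine mul_le_mul_of_nonneg_left (h1.trans ?_) (norm_nonneg _)
        refine mul_le_mul_of_nonneg_left ?_ K.2
        rw [h2]
        exact (s k).le_opNorm _
    _ = (‖T ^ k * p‖ * ‖s k‖) * (K * ‖q ((T ^ k) l)‖) := by ring
    _ ≤ N * (K * ‖q ((T ^ k) l)‖) :=
        mul_le_mul_of_nonneg_right (hN k) (mul_nonneg K.2 (norm_nonneg _))
    _ = N * K * ‖q ((T ^ k) l)‖ := by ring

theorem continuous_frame_apply (i : Fin n) : Continuous fun x : Frame ℂ n X => x.1 i :=
  (continuous_apply i).comp continuous_subtype_val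

/-- A part of the operator dominating another nonzero part has rank at most one. -/
theorem not_linearIndependent_pair {L : Submodule ℂ X}
    (hL : IsStronglySupercyclicSubspace 2 T L)
    {p q : X →L[ℂ] X} {s : ℕ → X →L[ℂ] X} {N : ℝ} (hp : IsIdempotentElem p)
    (hq : IsIdempotentElem q) (hqp : q * p = 0) (hp0 : p ≠ 0) (hTp : Commute T p)
    (hTq : Commute T q) (hs : ∀ k, s k * T ^ k = q) (hN : ∀ k, ‖T ^ k * p‖ * ‖s k‖ ≤ N)
    {e₁ e₂ : X} (he₁ : q e₁ = e₁) (he₂ : q e₂ = e₂) : ¬ LinearIndependent ℂ ![e₁, e₂] := by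
  intro he
  have hqe : (fun i => q (![e₁, e₂] i)) = ![e₁, e₂] := by
    funext i
    fin_cases i <;> simp [he₁, he₂]
  -- Independence of the images under `q` is an open condition, so `q` is injective on some `T ^ k
  -- (L)`; since `q` commutes with `T`, this passes back to `L`.
  obtain ⟨k, x, hx, hxk⟩ := hL.exists_frame_mem
    (O := {x : Frame ℂ 2 X | LinearIndependent ℂ fun i => q (x.1 i)})
    (isOpen_setOfPred_linearIndependent.preimage
      (continuous_pi fun i => q.continuous.comp (continuous_frame_apply i)))
    ⟨⟨![e₁, e₂], he⟩, by simpa [hqe] using he⟩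
  have hinj : ∀ l ∈ L, q l = 0 → l = 0 := by
    intro l hl hql
    refine hL.eq_zero_of_pow_apply_eq_zero (k := k) hl ?_
    have hmem : (T ^ k) l ∈ Submodule.span ℂ (range x.1) := by
      rw [hxk]
      exact Submodule.mem_map_of_mem hl
    have hq0 : q ((T ^ k) l) = 0 := by
      have : q ((T ^ k) l) = (T ^ k) (q l) :=
        congrArg (fun f : X →L[ℂ] X => f l) (hTq.pow_left k).eq.symm
      rw [this, hql, map_zero]
    obtain ⟨c, hc⟩ := (Submodule.mem_span_range_iff_exists_fun ℂ).1 hmem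
    rw [← hc, map_sum] at hq0
    simp only [map_smul] at hq0
    have hc0 := Fintype.linearIndependent_iff.1 hx c hq0
    rw [← hc]
    simp [hc0]
  obtain ⟨C, hC⟩ := hL.exists_bound_of_injOn hq hTp hTq hs hN hinj
  obtain ⟨u, hu⟩ : ∃ u, p u ≠ 0 := by
    by_contra! h
    exact hp0 (ContinuousLinearMap.ext h)
  have hpu : p (p u) = p u := congrArg (fun f : X →L[ℂ] X => f u) hp.eq
  have hqu : q (p u) = 0 := congrArg (fun f : X →L[ℂ] X => f u) hqp
  have hind : LinearIndependent ℂ ![p u, e₁] := by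
    rw [LinearIndependent.pair_iff' hu]
    intro c hc
    have h0 : q e₁ = 0 := by rw [← hc, map_smul, hqu, smul_zero]
    exact he.ne_zero 0 (he₁.symm.trans h0)
  -- Frames whose first vector is close to `p u`, which `q` kills, violate the bound.
  obtain ⟨m, y, hy, hym⟩ := hL.exists_frame_mem
    (O := {x : Frame ℂ 2 X | C * ‖q (x.1 0)‖ < ‖p (x.1 0)‖})
    (isOpen_lt
      (continuous_const.mul (q.continuous.comp (continuous_frame_apply 0)).norm)
      (p.continuous.comp (continuous_frame_apply 0)).norm)
    ⟨⟨![p u, e₁], hind⟩, by simpa [hqu, hpu] using hu⟩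
  refine absurd (hC m (y.1 0) ?_) (not_le.2 hy)
  rw [← hym]
  exact Submodule.subset_span (mem_range_self 0)

theorem restrict_pow_apply {X₀ : Submodule ℂ X} (hX₀ : ∀ x ∈ X₀, T x ∈ X₀) (k : ℕ) (x : X₀) :
    (((T.restrict hX₀) ^ k) x : X) = (T ^ k) x := by
  induction k with
  | zero => simp
  | succ k ih =>
    rw [pow_succ', pow_succ']
    change T ((((T.restrict hX₀) ^ k) x : X₀) : X) = T ((T ^ k) x)
    rw [ih]

/-- The restriction of a strongly `2`-supercyclic operator to an invariant hyperplane is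
supercyclic. -/
theorem isSupercyclic_restrict {L X₀ : Submodule ℂ X}
    (hL : IsStronglySupercyclicSubspace 2 T L) (hX₀ : ∀ x ∈ X₀, T x ∈ X₀) (f : X →L[ℂ] ℂ)
    {v : X} (hv : f v = 1) (hf : ∀ x, x ∈ X₀ ↔ f x = 0) :
    IsSupercyclic (T.restrict hX₀) := by
  have := hL.finiteDimensional
  obtain ⟨y, hy, hy0⟩ := (Submodule.ne_bot_iff _).1
    (LinearMap.ker_ne_bot_of_finrank_lt (f := f.toLinearMap.domRestrict L)
      (by rw [hL.finrank_eq]; simp))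
  have hfy : f y = 0 := hy
  refine ⟨⟨y, (hf _).2 hfy⟩, Metric.dense_iff.2 fun x ε hε => ?_⟩
  by_cases hx : x = 0
  · exact ⟨0, by simpa [hx] using hε, ⟨(0, 0), by simp⟩⟩
  have hfx : f x = 0 := (hf _).1 x.2
  have hx' : (x : X) ≠ 0 := fun h => hx (Subtype.ext h)
  have hind : LinearIndependent ℂ ![(x : X), v] := by
    rw [LinearIndependent.pair_iff' hx']
    intro c hc
    have h0 : f v = 0 := by rw [← hc, map_smul, hfx, smul_zero]
    exact one_ne_zero (hv.symm.trans h0)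
  -- The combination of the frame vectors killed by `f` is to approximate `x`. With the denominator
  -- `f (z.1 1)` cleared, the condition is visibly open, and its strictness forces `f (z.1 1) ≠ 0`.
  obtain ⟨k, z, hz, hzk⟩ := hL.exists_frame_mem
    (O := {z : Frame ℂ 2 X |
      ‖f (z.1 1) • z.1 0 - f (z.1 0) • z.1 1 - f (z.1 1) • (x : X)‖ < ε * ‖f (z.1 1)‖})
    (by
      have h0 := continuous_frame_apply (X := X) (0 : Fin 2)
      have h1 := continuous_frame_apply (X := X) (1 : Fin 2)
      have hf0 := f.continuous.comp h0
      have hf1 := f.continuous.comp h1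
      exact isOpen_lt (((hf1.smul h0).sub (hf0.smul h1)).sub (hf1.smul continuous_const)).norm
        (continuous_const.mul hf1.norm))
    ⟨⟨![x, v], hind⟩, by simpa [hfx, hv] using hε⟩
  have hz : ‖f (z.1 1) • z.1 0 - f (z.1 0) • z.1 1 - f (z.1 1) • (x : X)‖ <
    ε * ‖f (z.1 1)‖ := hz
  have hf1 : f (z.1 1) ≠ 0 := by
    intro h
    rw [h, norm_zero, mul_zero] at hz
    exact (norm_nonneg _).not_gt hz
  have hmem : ∀ i, z.1 i ∈ L.map (T ^ k).toLinearMap := fun i => by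
    rw [← hzk]
    exact Submodule.subset_span (mem_range_self i)
  obtain ⟨l₁, hl₁, hl₁z⟩ := hmem 1
  set w := z.1 0 - (f (z.1 1))⁻¹ • f (z.1 0) • z.1 1 with hw
  obtain ⟨l, hl, hlw⟩ : w ∈ L.map (T ^ k).toLinearMap :=
    Submodule.sub_mem _ (hmem 0) (Submodule.smul_mem _ _ (Submodule.smul_mem _ _ (hmem 1)))
  have hfw : f w = 0 := by
    rw [hw, map_sub, map_smul, map_smul, smul_eq_mul, smul_eq_mul]
    field_simp
    ring
  have hwx : ‖w - x‖ < ε := by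
    have he : f (z.1 1) • z.1 0 - f (z.1 0) • z.1 1 - f (z.1 1) • (x : X) =
        f (z.1 1) • (w - x) := by
      rw [hw, smul_sub, smul_sub, smul_inv_smul₀ hf1]
    rw [he, norm_smul, mul_comm] at hz
    exact lt_of_mul_lt_mul_right hz (norm_nonneg _)
  -- The kernel of `f ∘ T ^ k` on the plane `L` is a line containing both `y` and the preimage `l`
  -- of `w`; hence `w` is a multiple of `T ^ k y`.
  let g : L →ₗ[ℂ] ℂ := (f.toLinearMap ∘ₗ (T ^ k).toLinearMap).domRestrict L
  have hg : g ≠ 0 := fun h => hf1 (by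
    rw [← hl₁z]
    exact LinearMap.congr_fun h ⟨l₁, hl₁⟩)
  have hker : Module.finrank ℂ (LinearMap.ker g) = 1 := by
    have h := g.finrank_range_add_finrank_ker
    rw [LinearMap.range_eq_top.2 (LinearMap.surjective hg), finrank_top, Module.finrank_self,
      hL.finrank_eq] at h
    omega
  have hyk : f ((T ^ k) y) = 0 := by
    rw [← hf, ← restrict_pow_apply hX₀ k ⟨y, (hf _).2 hfy⟩]
    exact Subtype.property _
  obtain ⟨c, hc⟩ := (finrank_eq_one_iff_of_nonzero' (⟨y, hyk⟩ : LinearMap.ker g)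
    fun h => hy0 (congrArg Subtype.val h)).1 hker
    ⟨⟨l, hl⟩, (congrArg f hlw).trans hfw⟩
  have hcl : c • (y : X) = l := congrArg (fun u : LinearMap.ker g => ((u : L) : X)) hc
  have hcw : c • (T ^ k) (y : X) = w := by
    rw [← map_smul, hcl]
    exact hlw
  refine ⟨_, ?_, ⟨(c, k), rfl⟩⟩
  rw [Metric.mem_ball, Subtype.dist_eq, Submodule.coe_smul, restrict_pow_apply, dist_eq_norm]
  change ‖c • (T ^ k) (y : X) - x‖ < ε
  rwa [hcw]

end LinDyn.IsStronglySupercyclicSubspace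

end Dynamics

theorem corollary3p4 {X : Type*} [NormedAddCommGroup X] [NormedSpace ℂ X] [CompleteSpace X]
    (T : X →L[ℂ] X) (hT : LinDyn.IsStronglySupercyclic 2 T) :
    -- some circle centred at the origin meets every connected component of the spectrum
    (∃ R : ℝ, 0 ≤ R ∧ ∀ z ∈ spectrum ℂ T,
      (connectedComponentIn (spectrum ℂ T) z ∩ {w : ℂ | ‖w‖ = R}).Nonempty) ∨
    -- `T = a ⊕ S` on `X = F ⊕ X₀`
    (∃ (a : ℂ) (F X₀ : Submodule ℂ X) (hX₀ : ∀ x ∈ X₀, T x ∈ X₀),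
      a ≠ 0 ∧ Module.finrank ℂ F = 1 ∧ IsClosed (X₀ : Set X) ∧ IsCompl F X₀ ∧
      (∀ x ∈ F, T x = a • x) ∧
      LinDyn.IsSupercyclic (T.restrict hX₀)) ∨
    -- `T = a ⊕ b ⊕ S` on `X = F₁ ⊕ F₂ ⊕ X₀`
    (∃ (a b : ℂ) (F₁ F₂ X₀ : Submodule ℂ X) (hX₀ : ∀ x ∈ X₀, T x ∈ X₀),
      a ≠ 0 ∧ b ≠ 0 ∧ Module.finrank ℂ F₁ = 1 ∧ Module.finrank ℂ F₂ = 1 ∧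
      IsClosed (X₀ : Set X) ∧ DirectSum.IsInternal ![F₁, F₂, X₀] ∧
      (∀ x ∈ F₁, T x = a • x) ∧ (∀ x ∈ F₂, T x = b • x) ∧
      LinDyn.IsHypercyclic
        ((a⁻¹ • T.restrict hX₀).prodMap (b⁻¹ • T.restrict hX₀))) := by
  obtain ⟨L, hL⟩ := hT
  rw [or_iff_not_imp_left]
  intro hcirc
  -- The second alternative always holds here; the third is never needed.
  left
  obtain ⟨r, hr, U, V, hU, hV, hUr, hVr, hUc, hVc, hUn, hVn⟩ :=
    exists_circle_separating (spectrum.isCompact T) hcirc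
  obtain ⟨p, q, s, N, hp, hq, hqp, hp0, hq0, hTp, hTq, hs, hN⟩ :=
    exists_spectral_idempotents hr hU hV hUr hVr hUc hVc hUn hVn
  obtain ⟨u, hu⟩ : ∃ u, q u ≠ 0 := by
    by_contra! h
    exact hq0 (ContinuousLinearMap.ext h)
  have hqq : ∀ x, q (q x) = q x := fun x => congrArg (fun f : X →L[ℂ] X => f x) hq.eq
  have hTqx : ∀ x, T (q x) = q (T x) := fun x => congrArg (fun f : X →L[ℂ] X => f x) hTq.eq
  set v := q u with hv
  have hrank : ∀ x, ∃ c : ℂ, c • v = q x := by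
    intro x
    have := hL.not_linearIndependent_pair hp hq hqp hp0 hTp hTq hs hN (hqq u) (hqq x)
    rw [LinearIndependent.pair_iff' hu] at this
    push Not at this
    exact this
  -- `g ∘ q` is a continuous functional with value `1` at `v` and the same kernel as `q`.
  obtain ⟨g, hg⟩ := SeparatingDual.exists_eq_one (R := ℂ) hu
  have hgq : ∀ x, q x = g (q x) • v := by
    intro x
    obtain ⟨c, hc⟩ := hrank x
    rw [← hc, map_smul, hg, smul_eq_mul, mul_one]
  have hker : ∀ x, x ∈ LinearMap.ker (g.comp q).toLinearMap ↔ q x = 0 := by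
    intro x
    refine ⟨fun h => ?_, fun h => ?_⟩
    · have h' : g (q x) = 0 := h
      rw [hgq, h', zero_smul]
    · change g (q x) = 0
      rw [h, map_zero]
  have hX₀ : ∀ x ∈ LinearMap.ker (g.comp q).toLinearMap,
      T x ∈ LinearMap.ker (g.comp q).toLinearMap := by
    intro x hx
    rw [hker] at hx ⊢
    rw [← hTqx, hx, map_zero]
  have hqv : q v = v := hqq u
  have hTv : T v = g (T v) • v := by
    have h := hgq (T v)
    rwa [← hTqx, hqv] at h
  refine ⟨g (T v), Submodule.span ℂ {v}, _, hX₀, ?_, finrank_span_singleton hu,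
    (g.comp q).isClosed_ker, ?_, ?_,
    hL.isSupercyclic_restrict hX₀ (g.comp q) (v := v) (by simp [hqv, hg]) fun x => Iff.rfl⟩
  -- The eigenvalue is nonzero because `s 1` inverts `T` on the range of `q`.
  · intro h
    rw [h, zero_smul] at hTv
    have h1 : s 1 (T v) = q v := by
      have := hs 1
      rw [pow_one] at this
      exact congrArg (fun f : X →L[ℂ] X => f v) this
    rw [hTv, map_zero, hqv] at h1
    exact hu h1.symm
  · rw [isCompl_iff, Submodule.disjoint_def, codisjoint_iff, eq_top_iff]
    refine ⟨fun x hx hx0 => ?_, fun x _ => ?_⟩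
    · obtain ⟨c, rfl⟩ := Submodule.mem_span_singleton.1 hx
      rw [hker, map_smul, hqv] at hx0
      exact hx0
    · rw [Submodule.mem_sup]
      refine ⟨q x, Submodule.mem_span_singleton.2 (hrank x), x - q x, ?_, add_sub_cancel _ _⟩
      rw [hker, map_sub, hqq, sub_self]
  · intro x hx
    obtain ⟨c, rfl⟩ := Submodule.mem_span_singleton.1 hx
    rw [map_smul, smul_comm, ← hTv]
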